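/- Let $\mathbb{K}$ be a field, let $r\ge 2$, and let $S=\mathbb{K}[x_1,\dots,x_r]$ with its $\mathbb{N}^r$-grading, in which the part of degree $u$ is $\mathbb{K}x^u$. Let $M$ be a finitely generated $\mathbb{N}^r$-graded $S$-module, and let $\mathfrak{p}=\langle x_1-x_2,\dots,x_{r-1}-x_r\rangle\subseteq S$, so that $S/\mathfrak{p}\cong\mathbb{K}[x]$ by sending the class of every $x_i$ to $x$. For a module $N$ over an integral domain $R$ with field of fractions $Q$, write $\operatorname{rk}_R(N)=\dim_Q(N\otimes_R Q)$. Then $$\operatorname{rk}_S(M)=\operatorname{rk}_{S/\mathfrak{p}}(M\otimes_S S/\mathfrak{p}).$$ Consequently, the number of infinite bars of $M\otimes_S S/\mathfrak{p}$ equals $\operatorname{rk}_S(M)$. That is, regard $M\otimes_S S/\mathfrak{p}$ as an $\mathbb{N}$-graded $\mathbb{K}[x]$-module, whose part of degree $d$ is generated by the elements $m\otimes \bar s$ with $m\in M_u$, with $s\in S$ homogeneous of total degree $k$, and with $u_1+\dots+u_r+k=d$. This module has a barcode: there are integers $n,l\ge 0$, $a_i,b_j\ge 0$ and $c_j\geq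 1$ and an isomorphism of $\mathbb{N}$-graded $\mathbb{K}[x]$-modules $$M\otimes_S S/\mathfrak{p}\;\cong\;\bigoplus_{i=1}^{n} x^{a_i}\mathbb{K}[x]\;\oplus\;\bigoplus_{j=1}^{l} x^{b_j}\mathbb{K}[x]/(x^{b_j+c_j}),$$ where the infinite bars are the intervals $[a_i,\infty)$ and the finite bars are the intervals $[b_j,b_j+c_j)$; and in every such decomposition the number $n$ of infinite bars equals $\operatorname{rk}_S(M)$. -/

import Mathlib

open scoped TensorProduct

noncomputable section

namespace DiagonalRank

universe u v

/-- The rank of a module `M` over an integral domain `R`: the dimension of `M ⊗_R Q` over the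
field of fractions `Q` of `R`. -/
def rk (R : Type u) [CommRing R] [IsDomain R] (M : Type v) [AddCommGroup M] [Module R M] :
    Cardinal.{max u v} :=
  Module.rank (FractionRing R) (FractionRing R ⊗[R] M)

/-- The family `𝓜` of subgroups is an `ℕ^r`-grading of the module `M` over `K[x_1, …, x_r]`, where
the polynomial ring carries its fine grading: its part of degree `u` consists of the multiples
`c x^u` of the monomial `x^u`. -/
structure IsMultigrading (K : Type u) [Field K] {r : ℕ} {M : Type v} [AddCommGroup M]
    [Module (MvPolynomial (Fin r) K) M] (𝓜 : (Fin r →₀ ℕ) → AddSubgroup M) : Prop where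
  isInternal : DirectSum.IsInternal 𝓜
  smul_mem : ∀ (u v : Fin r →₀ ℕ) (c : K) (m : M), m ∈ 𝓜 v →
    MvPolynomial.monomial u c • m ∈ 𝓜 (u + v)

/-- The ideal `⟨x_1 - x_2, …, x_{r-1} - x_r⟩` of the diagonal. -/
def diagIdeal (K : Type u) [Field K] (r : ℕ) : Ideal (MvPolynomial (Fin r) K) :=
  Ideal.span {f | ∃ (i : ℕ) (h : i + 1 < r),
    f = MvPolynomial.X ⟨i, Nat.lt_of_succ_lt h⟩ - MvPolynomial.X ⟨i + 1, h⟩}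

/-- The coordinate ring `S / p` of the diagonal. -/
abbrev DiagRing (K : Type u) [Field K] (r : ℕ) : Type u :=
  MvPolynomial (Fin r) K ⧸ diagIdeal K r

/-- The map `S / p → K[x]` that sends the class of each variable to `x`. -/
def diagToPoly (K : Type u) [Field K] (r : ℕ) : DiagRing K r →ₐ[K] Polynomial K :=
  Ideal.Quotient.liftₐ (diagIdeal K r) (MvPolynomial.aeval fun _ => Polynomial.X) (by
    intro a ha
    have h : diagIdeal K r ≤ RingHom.ker
        (MvPolynomial.aeval (R := K) fun _ : Fin r => (Polynomial.X : Polynomial K)) := by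
      refine Ideal.span_le.2 ?_
      rintro f ⟨i, hi, rfl⟩
      simp [RingHom.mem_ker]
    exact h ha)

theorem diagToPoly_mk_X (K : Type u) [Field K] (r : ℕ) (i : Fin r) :
    diagToPoly K r (Ideal.Quotient.mk (diagIdeal K r) (MvPolynomial.X i)) = Polynomial.X :=
  MvPolynomial.aeval_X (fun _ => (Polynomial.X : Polynomial K)) i

theorem mk_X_eq (K : Type u) [Field K] (r : ℕ) [NeZero r] (i : Fin r) :
    Ideal.Quotient.mk (diagIdeal K r) (MvPolynomial.X i)
      = Ideal.Quotient.mk (diagIdeal K r) (MvPolynomial.X 0) := by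
  obtain ⟨n, hn⟩ := i
  induction n with
  | zero => rfl
  | succ n ih =>
    rw [← ih (Nat.lt_of_succ_lt hn)]
    refine (Ideal.Quotient.eq.2 ?_).symm
    exact Ideal.subset_span ⟨n, hn, rfl⟩

/-- The isomorphism `S / p ≃ K[x]` that sends the class of each variable to `x`. -/
def diagEquiv (K : Type u) [Field K] (r : ℕ) [NeZero r] : DiagRing K r ≃ₐ[K] Polynomial K :=
  AlgEquiv.ofAlgHom (diagToPoly K r)
    (Polynomial.aeval (Ideal.Quotient.mk (diagIdeal K r) (MvPolynomial.X 0)))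
    (by
      apply Polynomial.algHom_ext
      simp [diagToPoly_mk_X])
    (by
      apply Ideal.Quotient.algHom_ext
      apply MvPolynomial.algHom_ext
      intro i
      simpa [diagToPoly_mk_X] using (mk_X_eq K r i).symm)

instance diagRing_isDomain (K : Type u) [Field K] (r : ℕ) [NeZero r] : IsDomain (DiagRing K r) :=
  (diagEquiv K r).toMulEquiv.isDomain (Polynomial K)

/-- The intersection `M ⊗_S S / p` of `M` with the diagonal. -/
def DiagIntersection (K : Type u) [Field K] (r : ℕ) (M : Type v) [AddCommGroup M]
    [Module (MvPolynomial (Fin r) K) M] : Type (max u v) :=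
  DiagRing K r ⊗[MvPolynomial (Fin r) K] M

section

variable (K : Type u) [Field K] (r : ℕ) (M : Type v) [AddCommGroup M]
  [Module (MvPolynomial (Fin r) K) M]

instance : AddCommGroup (DiagIntersection K r M) :=
  inferInstanceAs (AddCommGroup (DiagRing K r ⊗[MvPolynomial (Fin r) K] M))

instance : Module (DiagRing K r) (DiagIntersection K r M) :=
  inferInstanceAs (Module (DiagRing K r) (DiagRing K r ⊗[MvPolynomial (Fin r) K] M))

/-- The structure of a `K[x]`-module on `M ⊗_S S / p`, through the isomorphism `S / p ≃ K[x]`. -/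
instance [NeZero r] : Module (Polynomial K) (DiagIntersection K r M) :=
  Module.compHom _ (diagEquiv K r).symm.toRingEquiv.toRingHom

end

/-- The `ℕ`-grading of `M ⊗_S S / p` as a tensor product, where `M` and `S / p` are graded by total
degree: its part of degree `d` is generated by the tensors of `m` and the class of `s`, with
`m ∈ M_u`, with `s` a homogeneous polynomial of degree `k`, and with `|u| + k = d`. -/
def diagGrading (K : Type u) [Field K] {r : ℕ} {M : Type v} [AddCommGroup M]
    [Module (MvPolynomial (Fin r) K) M] (𝓜 : (Fin r →₀ ℕ) → AddSubgroup M) (d : ℕ) :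
    AddSubgroup (DiagIntersection K r M) :=
  AddSubgroup.closure {y | ∃ (u : Fin r →₀ ℕ) (k : ℕ) (m : M) (s : MvPolynomial (Fin r) K),
    m ∈ 𝓜 u ∧ s.IsHomogeneous k ∧ u.degree + k = d ∧
    y = (Ideal.Quotient.mk (diagIdeal K r) s ⊗ₜ[MvPolynomial (Fin r) K] m :
      DiagRing K r ⊗[MvPolynomial (Fin r) K] M)}

/-- A finite collection of infinite intervals `[a_i, ∞)` and of finite non-empty intervals
`[b_j, b_j + c_j)`. -/
structure Barcode where
  numInfinite : ℕ
  infBirth : Fin numInfinite → ℕ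
  numFinite : ℕ
  finBirth : Fin numFinite → ℕ
  finLength : Fin numFinite → ℕ
  finLength_pos : ∀ j, 0 < finLength j

/-- `f` lies in the part of degree `d` of `K[x](-a) = x^a K[x]`, the free module whose generator
`1` has degree `a`: it is a multiple of `x^(d - a)`, and it is zero if `d < a`. -/
def IsShiftedHomogeneous {K : Type u} [Field K] (a d : ℕ) (f : Polynomial K) : Prop :=
  ∀ n, f.coeff n ≠ 0 → n + a = d

/-- `B` is the barcode of the `ℕ`-graded `K[x]`-module `N` with grading `𝓝`: as a graded module,
`N` is isomorphic to `⨁ i, K[x](-a_i) ⊕ ⨁ j, (K[x] / x^(c_j))(-b_j)`, where the `[a_i, ∞)` and the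
`[b_j, b_j + c_j)` are the intervals in `B`. -/
def IsBarcodeOf (K : Type u) [Field K] {N : Type v} [AddCommGroup N] [Module (Polynomial K) N]
    (𝓝 : ℕ → AddSubgroup N) (B : Barcode) : Prop :=
  ∃ e : N ≃ₗ[Polynomial K] ((Fin B.numInfinite → Polynomial K) ×
      ((j : Fin B.numFinite) → Polynomial K ⧸
        Ideal.span {(Polynomial.X : Polynomial K) ^ B.finLength j})),
    ∀ (d : ℕ) (y : N), y ∈ 𝓝 d ↔
      (∀ i, IsShiftedHomogeneous (B.infBirth i) d ((e y).1 i)) ∧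
      (∀ j, ∃ f : Polynomial K, IsShiftedHomogeneous (B.finBirth j) d f ∧
        Ideal.Quotient.mk _ f = (e y).2 j)

end DiagonalRank

end

noncomputable section

namespace DiagonalRank

universe u v

/-! Up to a monomial, `M` is free. There are maps `φ : S^n → M` and `ψ : M → S^n` whose two
composites are both multiplication by one monomial `x^w`
(`IsMultigrading.exists_comp_eq_monomial_smul`). Tensoring with `S/p` is not exact, but it preserves
these two identities, and `x^w` becomes a power of `x`, which is nonzero in the domain `S/p`. Maps
that are mutually inverse up to a nonzero scalar become isomorphisms over the fraction field, so
both ranks equal `n`.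

To get `φ`, multiply homogeneous generators into a common degree `w`, high enough to avoid monomial
torsion, and take a `K`-basis of their span. Every component of a relation among these elements is a
monomial times a `K`-linear relation, so they are independent over `S`; their span contains `x^w M`.

The barcode exists because, among homogeneous generating families with fixed degrees, one whose
annihilating powers of `x` are minimal has only termwise relations
(`IsPolyGrading.exists_independent_generators`). The number of infinite bars is a rank: a large
power of `x` kills every finite bar. -/

theorem rk_eq_of_comp_eq_smul (R : Type u) [CommRing R] [IsDomain R] (N : Type v) [AddCommGroup N]
    [Module R N] {n : ℕ} (φ : (Fin n → R) →ₗ[R] N) (ψ : N →ₗ[R] (Fin n → R)) {s : R}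
    (hs : s ≠ 0) (hψφ : ψ ∘ₗ φ = s • LinearMap.id) (hφψ : φ ∘ₗ ψ = s • LinearMap.id) :
    rk R N = n := by
  have h1 : ψ.baseChange (FractionRing R) ∘ₗ φ.baseChange (FractionRing R)
      = s • LinearMap.id := by
    rw [← LinearMap.baseChange_comp, hψφ, LinearMap.baseChange_smul, LinearMap.baseChange_id]
  have h2 : φ.baseChange (FractionRing R) ∘ₗ ψ.baseChange (FractionRing R)
      = s • LinearMap.id := by
    rw [← LinearMap.baseChange_comp, hφψ, LinearMap.baseChange_smul, LinearMap.baseChange_id]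
  have hs' : algebraMap R (FractionRing R) s ≠ 0 := by
    simpa using hs
  have hbij : Function.Bijective (φ.baseChange (FractionRing R)) := by
    constructor
    · rw [injective_iff_map_eq_zero]
      intro x hx
      have := LinearMap.congr_fun h1 x
      simp only [LinearMap.comp_apply, hx, map_zero, LinearMap.smul_apply, LinearMap.id_apply] at this
      rw [← algebraMap_smul (FractionRing R) s x] at this
      exact (smul_eq_zero.1 this.symm).resolve_left hs'
    · intro y
      refine ⟨ψ.baseChange (FractionRing R) ((algebraMap R (FractionRing R) s)⁻¹ • y), ?_⟩
      have := LinearMap.congr_fun h2 ((algebraMap R (FractionRing R) s)⁻¹ • y)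
      simp only [LinearMap.comp_apply, LinearMap.smul_apply, LinearMap.id_apply] at this
      rw [this, ← algebraMap_smul (FractionRing R) s, smul_inv_smul₀ hs']
  have := (LinearEquiv.ofBijective _ hbij).lift_rank_eq
  rw [Module.rank_baseChange, rank_fun'] at this
  unfold rk
  simpa using this.symm

/-- Expressing `rk` through `Module.rank` lets the rank be transported along `S/p ≃ K[x]` without
comparing fraction fields. -/
theorem lift_rank_eq_rk (R : Type u) [CommRing R] [IsDomain R] (N : Type v) [AddCommGroup N]
    [Module R N] : Cardinal.lift.{u} (Module.rank R N) = rk R N := by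
  unfold rk
  rw [IsLocalization.rank_eq (FractionRing R) (nonZeroDivisors R) le_rfl]
  have := IsLocalizedModule.lift_rank_eq (nonZeroDivisors R)
    (TensorProduct.mk R (FractionRing R) N 1) le_rfl
  rw [Cardinal.lift_id'.{v, u}, Cardinal.lift_umax.{v, u}] at this
  exact this.symm

/-! ### Projections and homogeneous generators -/

section Grading

variable {ι : Type*} [DecidableEq ι] {M : Type*} [AddCommGroup M] {𝓜 : ι → AddSubgroup M}

theorem exists_projection (h : DirectSum.IsInternal 𝓜) (T : ι → Prop) [DecidablePred T] :
    ∃ P : M →+ M, ∀ i, ∀ m ∈ 𝓜 i, P m = if T i then m else 0 := by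
  have h' : Function.Bijective (DirectSum.coeAddMonoidHom 𝓜) := h
  refine ⟨(DirectSum.toAddMonoid fun i => if T i then (𝓜 i).subtype else 0).comp
    (AddEquiv.ofBijective _ h').symm.toAddMonoidHom, fun i m hm => ?_⟩
  have : (AddEquiv.ofBijective _ h').symm m = DirectSum.of (fun i => 𝓜 i) i ⟨m, hm⟩ := by
    rw [AddEquiv.symm_apply_eq]
    exact (DirectSum.coeAddMonoidHom_of 𝓜 i ⟨m, hm⟩).symm
  simp only [AddMonoidHom.comp_apply, AddEquiv.coe_toAddMonoidHom, this,
    DirectSum.toAddMonoid_of]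
  split_ifs <;> simp

theorem isInternal_induction (h : DirectSum.IsInternal 𝓜) {p : M → Prop} (zero : p 0)
    (mem : ∀ i, ∀ m ∈ 𝓜 i, p m) (add : ∀ x y, p x → p y → p (x + y)) (m : M) : p m := by
  obtain ⟨x, rfl⟩ := h.surjective m
  induction x using DirectSum.induction_on with
  | zero => simpa using zero
  | of i x => simpa using mem i x x.2
  | add x y hx hy => simpa using add _ _ hx hy

end Grading

section Generators

variable {R : Type*} [CommRing R] {M : Type*} [AddCommGroup M] [Module R M] [Module.Finite R M]
  {ι : Type*} {𝓜 : ι → AddSubgroup M}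

theorem exists_homogeneous_generators
    (h : Submodule.span R {m | ∃ i, m ∈ 𝓜 i} = ⊤) :
    ∃ (n : ℕ) (g : Fin n → M) (a : Fin n → ι), (∀ i, g i ∈ 𝓜 (a i)) ∧
      Submodule.span R (Set.range g) = ⊤ := by
  obtain ⟨t, ht, hspan⟩ := (Submodule.fg_span_iff_fg_span_finset_subset {m | ∃ i, m ∈ 𝓜 i}).1
    (h ▸ Module.Finite.fg_top)
  choose a ha using fun x : t => ht x.2
  refine ⟨t.card, fun i => t.equivFin.symm i, fun i => a (t.equivFin.symm i), fun i => ha _, ?_⟩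
  rw [← h, hspan]
  congr 1
  ext x
  constructor
  · rintro ⟨i, rfl⟩
    exact (t.equivFin.symm i).2
  · intro hx
    exact ⟨t.equivFin ⟨x, hx⟩, by simp⟩

end Generators

/-! ### Multigraded modules are free up to a monomial -/

section Multigraded

open MvPolynomial

variable {K : Type u} [Field K] {r : ℕ} {M : Type v} [AddCommGroup M]
  [Module (MvPolynomial (Fin r) K) M] {𝓜 : (Fin r →₀ ℕ) → AddSubgroup M}

theorem IsMultigrading.span_eq_top (h : IsMultigrading K 𝓜) :
    Submodule.span (MvPolynomial (Fin r) K) {m | ∃ u, m ∈ 𝓜 u} = ⊤ := by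
  rw [eq_top_iff]
  intro m _
  exact isInternal_induction h.isInternal
    (p := fun m => m ∈ Submodule.span (MvPolynomial (Fin r) K) {m | ∃ u, m ∈ 𝓜 u}) (zero_mem _)
    (fun u m hm => Submodule.subset_span ⟨u, hm⟩) (fun _ _ => add_mem) m

/-- All-ones exponent vectors dominate every exponent vector after scaling. -/
theorem exists_le_nsmul_ones (v : Fin r →₀ ℕ) :
    ∃ n : ℕ, v ≤ n • Finsupp.equivFunOnFinite.symm (fun _ : Fin r => 1) := by
  refine ⟨∑ i, v i, Finsupp.le_def.2 fun i => ?_⟩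
  simpa using Finset.single_le_sum (f := v) (fun _ _ => Nat.zero_le _) (Finset.mem_univ i)

/-- The torsion with respect to the monomials is killed by a single monomial. -/
theorem exists_monomial_smul_eq_zero [Module.Finite (MvPolynomial (Fin r) K) M] :
    ∃ t : Fin r →₀ ℕ, ∀ (v : Fin r →₀ ℕ) (m : M), monomial v (1 : K) • m = 0 →
      monomial t (1 : K) • m = 0 := by
  set w : Fin r →₀ ℕ := Finsupp.equivFunOnFinite.symm (fun _ : Fin r => 1) with hw
  have hpow : ∀ k : ℕ, monomial (k • w) (1 : K) = monomial w (1 : K) ^ k := fun k => by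
    simp [monomial_pow]
  -- The kernels of the powers of `x_1 ⋯ x_r` form an ascending chain, which stabilizes; every
  -- monomial divides such a power.
  let f : ℕ →o Submodule (MvPolynomial (Fin r) K) M :=
    ⟨fun k => LinearMap.ker (LinearMap.lsmul _ M (monomial (k • w) (1 : K))), by
      intro a b hab m hm
      obtain ⟨c, rfl⟩ := Nat.exists_eq_add_of_le' hab
      simp only [LinearMap.mem_ker, LinearMap.lsmul_apply, hpow] at hm ⊢
      rw [pow_add, mul_smul, hm, smul_zero]⟩
  obtain ⟨n, hn⟩ := monotone_stabilizes_iff_noetherian.2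
    (inferInstance : IsNoetherian (MvPolynomial (Fin r) K) M) f
  refine ⟨n • w, fun v m hm => ?_⟩
  obtain ⟨k, hk⟩ := exists_le_nsmul_ones v
  have h1 : m ∈ f (max n k) := by
    have : v ≤ max n k • w := hk.trans (nsmul_le_nsmul_left zero_le (le_max_right n k))
    obtain ⟨c, hc⟩ := exists_add_of_le this
    change monomial (max n k • w) (1 : K) • m = 0
    rw [hc, add_comm, ← one_mul (1 : K), ← monomial_mul, mul_smul, hm, smul_zero]
  rw [← hn _ (le_max_left n k)] at h1
  exact h1

/-- Addition of exponents is cancellative, so only the `x^v` term of `f` carries degree `u` to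
degree `u + v`. -/
theorem IsMultigrading.projection_smul (h : IsMultigrading K 𝓜) {P : M →+ M}
    {u v : Fin r →₀ ℕ} (hP : ∀ i, ∀ m ∈ 𝓜 i, P m = if i = u + v then m else 0)
    {m : M} (hm : m ∈ 𝓜 u) (f : MvPolynomial (Fin r) K) :
    P (f • m) = monomial v (f.coeff v) • m := by
  induction f using MvPolynomial.induction_on' with
  | monomial w c =>
    rw [hP _ _ (h.smul_mem w u c m hm), coeff_monomial]
    by_cases hwv : w = v
    · simp [hwv, add_comm]
    · rw [if_neg, if_neg hwv, map_zero, zero_smul]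
      rwa [add_comm, add_right_inj]
  | add f g hf hg => rw [add_smul, map_add, hf, hg, coeff_add, map_add, add_smul]

theorem IsMultigrading.exists_comp_eq_monomial_smul [Module.Finite (MvPolynomial (Fin r) K) M]
    (h : IsMultigrading K 𝓜) :
    ∃ (n : ℕ) (w : Fin r →₀ ℕ) (φ : (Fin n → MvPolynomial (Fin r) K) →ₗ[MvPolynomial (Fin r) K] M)
      (ψ : M →ₗ[MvPolynomial (Fin r) K] (Fin n → MvPolynomial (Fin r) K)),
      ψ ∘ₗ φ = monomial w (1 : K) • LinearMap.id ∧ φ ∘ₗ ψ = monomial w (1 : K) • LinearMap.id := by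
  classical
  obtain ⟨k, g, a, hg, hspan⟩ := exists_homogeneous_generators h.span_eq_top
  obtain ⟨t, ht⟩ := exists_monomial_smul_eq_zero (K := K) (r := r) (M := M)
  set w₀ : Fin r →₀ ℕ := Finset.univ.sup a
  have ha : ∀ i, a i ≤ w₀ := fun i => Finset.le_sup (Finset.mem_univ i)
  -- The summand `w₀` lets every generator be moved up to degree `w`; the summand `t` places the
  -- results in `x^t M`, where monomials act injectively.
  set w := t + w₀ with hw
  have haw : ∀ i, a i ≤ w := fun i => (ha i).trans le_add_self
  let _ : Module K M := Module.compHom M (C : K →+* MvPolynomial (Fin r) K)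
  have hC : ∀ (c : K) (m : M), c • m = (C c : MvPolynomial (Fin r) K) • m := fun _ _ => rfl
  have : IsScalarTower K (MvPolynomial (Fin r) K) M :=
    ⟨fun c f m => by rw [hC, smul_eq_C_mul, mul_smul]⟩
  set H : Fin k → M := fun i => monomial (w - a i) (1 : K) • g i with hH
  have hHmem : ∀ i, H i ∈ 𝓜 w := fun i => by
    have := h.smul_mem (w - a i) (a i) 1 (g i) (hg i)
    rwa [tsub_add_cancel_of_le (haw i)] at this
  have hHt : ∀ x ∈ Submodule.span K (Set.range H), ∃ y, x = monomial t (1 : K) • y := by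
    intro x hx
    induction hx using Submodule.span_induction with
    | mem x hx =>
      obtain ⟨i, rfl⟩ := hx
      refine ⟨monomial (w₀ - a i) (1 : K) • g i, ?_⟩
      rw [smul_smul, monomial_mul, one_mul, ← add_tsub_assoc_of_le (ha i)]
    | zero => exact ⟨0, by simp⟩
    | add x y _ _ hx hy =>
      obtain ⟨x, rfl⟩ := hx
      obtain ⟨y, rfl⟩ := hy
      exact ⟨x + y, by rw [smul_add]⟩
    | smul c x _ hx =>
      obtain ⟨x, rfl⟩ := hx
      exact ⟨c • x, by rw [hC, hC, smul_comm]⟩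
  have hinj : ∀ x ∈ Submodule.span K (Set.range H), ∀ v,
      (monomial v (1 : K) : MvPolynomial (Fin r) K) • x = 0 → x = 0 := by
    intro x hx v hv
    obtain ⟨y, rfl⟩ := hHt x hx
    rw [smul_smul, monomial_mul, one_mul] at hv
    exact ht _ _ hv
  obtain ⟨κ, b, hb, hbspan, hbli⟩ := exists_linearIndependent' K H
  have := Finite.of_injective b hb
  have := Fintype.ofFinite κ
  set G : Fin (Fintype.card κ) → M := fun i => H (b ((Fintype.equivFin κ).symm i)) with hG
  have hGli : LinearIndependent K G := hbli.comp _ (Fintype.equivFin κ).symm.injective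
  have hGmem : ∀ i, G i ∈ Submodule.span K (Set.range H) := fun i =>
    Submodule.subset_span ⟨_, rfl⟩
  let φ := Fintype.linearCombination (MvPolynomial (Fin r) K) G
  have hφ : ∀ f, φ f = ∑ i, f i • G i := fun f => Fintype.linearCombination_apply _ _ _
  have hφinj : Function.Injective φ := by
    rw [injective_iff_map_eq_zero]
    intro f hf
    rw [hφ] at hf
    ext i v
    -- All `G i` share the degree `w`, so the component of the relation in degree `w + v` is `x^v`
    -- times a `K`-combination of them. Cancelling `x^v` by `hinj` leaves a relation over `K`.
    obtain ⟨P, hP⟩ := exists_projection h.isInternal (fun i => i = w + v)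
    have h1 : (monomial v (1 : K) : MvPolynomial (Fin r) K) • ∑ i, coeff v (f i) • G i = 0 := by
      have := congr_arg P hf
      rw [map_sum, map_zero] at this
      rw [← this, Finset.smul_sum]
      refine Finset.sum_congr rfl fun i _ => ?_
      rw [h.projection_smul hP (hHmem _), hC, smul_smul, mul_comm, C_mul_monomial, mul_one]
    have h2 := hinj _ (Submodule.sum_mem _ fun i _ => Submodule.smul_mem _ _ (hGmem i)) v h1
    simpa using Fintype.linearIndependent_iff.1 hGli _ h2 i
  have hHrange : ∀ i, H i ∈ LinearMap.range φ := by
    have : Submodule.span K (Set.range H) ≤ (LinearMap.range φ).restrictScalars K := by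
      rw [← hbspan, Submodule.span_le]
      rintro _ ⟨j, rfl⟩
      refine ⟨Pi.single (Fintype.equivFin κ j) 1, ?_⟩
      rw [hφ, Finset.sum_eq_single (Fintype.equivFin κ j)]
      · simp [hG]
      · intro j' _ hj
        simp [Pi.single_eq_of_ne hj]
      · simp
    exact fun i => this (Submodule.subset_span ⟨i, rfl⟩)
  have hrange : ∀ m : M, monomial w (1 : K) • m ∈ LinearMap.range φ := by
    intro m
    have : Submodule.span (MvPolynomial (Fin r) K) (Set.range g) ≤
        (LinearMap.range φ).comap (LinearMap.lsmul _ M (monomial w (1 : K))) := by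
      rw [Submodule.span_le]
      rintro _ ⟨i, rfl⟩
      change monomial w (1 : K) • g i ∈ LinearMap.range φ
      have : monomial w (1 : K) • g i = monomial (a i) (1 : K) • H i := by
        rw [hH, smul_smul, monomial_mul, one_mul, add_tsub_cancel_of_le (haw i)]
      rw [this]
      exact Submodule.smul_mem _ _ (hHrange i)
    exact this (hspan ▸ Submodule.mem_top)
  -- Multiplication by `x^w` lands in the range of `φ`, so it factors through the inverse of `φ`
  -- there.
  let ψ := (LinearEquiv.ofInjective φ hφinj).symm.toLinearMap ∘ₗ
    (LinearMap.lsmul _ M (monomial w (1 : K))).codRestrict (LinearMap.range φ) hrange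
  have hφψ : ∀ m, φ (ψ m) = monomial w (1 : K) • m := fun m =>
    congr_arg Subtype.val ((LinearEquiv.ofInjective φ hφinj).apply_symm_apply
      ⟨monomial w (1 : K) • m, hrange m⟩)
  refine ⟨_, w, φ, ψ, LinearMap.ext fun f => hφinj ?_, LinearMap.ext hφψ⟩
  simp only [LinearMap.comp_apply, hφψ, LinearMap.smul_apply, LinearMap.id_apply, map_smul]

theorem IsMultigrading.exists_rk_eq [NeZero r] [Module.Finite (MvPolynomial (Fin r) K) M]
    (h : IsMultigrading K 𝓜) :
    ∃ n : ℕ, rk (MvPolynomial (Fin r) K) M = n ∧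
      rk (DiagRing K r) (DiagIntersection K r M) = n := by
  obtain ⟨n, w, φ, ψ, h1, h2⟩ := h.exists_comp_eq_monomial_smul
  refine ⟨n, rk_eq_of_comp_eq_smul _ _ φ ψ (by simp) h1 h2, ?_⟩
  let ε := TensorProduct.piScalarRight (MvPolynomial (Fin r) K) (DiagRing K r) (DiagRing K r)
    (Fin n)
  let s : DiagRing K r := Ideal.Quotient.mk _ (monomial w (1 : K))
  have hs : s ≠ 0 := by
    intro hs
    have : diagToPoly K r s = 0 := by rw [hs, map_zero]
    change aeval (fun _ => (Polynomial.X : Polynomial K)) (monomial w (1 : K)) = 0 at this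
    rw [aeval_monomial, map_one, one_mul, Finsupp.prod, Finset.prod_eq_zero_iff] at this
    obtain ⟨i, _, hi⟩ := this
    exact pow_ne_zero _ Polynomial.X_ne_zero hi
  refine rk_eq_of_comp_eq_smul (DiagRing K r) (DiagRing K r ⊗[MvPolynomial (Fin r) K] M)
    (φ.baseChange (DiagRing K r) ∘ₗ ε.symm.toLinearMap)
    (ε.toLinearMap ∘ₗ ψ.baseChange (DiagRing K r)) hs ?_ ?_
  · have : ψ.baseChange (DiagRing K r) ∘ₗ φ.baseChange (DiagRing K r)
        = monomial w (1 : K) • LinearMap.id := by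
      rw [← LinearMap.baseChange_comp, h1, LinearMap.baseChange_smul, LinearMap.baseChange_id]
    refine LinearMap.ext fun x => ?_
    have := LinearMap.congr_fun this (ε.symm x)
    simp only [LinearMap.comp_apply, LinearMap.smul_apply, LinearMap.id_apply,
      LinearEquiv.coe_coe] at this ⊢
    rw [this, ← algebraMap_smul (DiagRing K r) (monomial w (1 : K)), map_smul,
      LinearEquiv.apply_symm_apply]
    rfl
  · have : φ.baseChange (DiagRing K r) ∘ₗ ψ.baseChange (DiagRing K r)
        = monomial w (1 : K) • LinearMap.id := by
      rw [← LinearMap.baseChange_comp, h2, LinearMap.baseChange_smul, LinearMap.baseChange_id]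
    refine LinearMap.ext fun x => ?_
    have := LinearMap.congr_fun this x
    simp only [LinearMap.comp_apply, LinearMap.smul_apply, LinearMap.id_apply,
      LinearEquiv.coe_coe, LinearEquiv.symm_apply_apply] at this ⊢
    rw [this, ← algebraMap_smul (DiagRing K r) (monomial w (1 : K))]
    rfl

end Multigraded

/-! ### The total-degree grading on the diagonal -/

section Diagonal

open MvPolynomial

/-- The properties of an `ℕ`-grading of a `K[x]`-module that its structure theorem uses. -/
structure IsPolyGrading (K : Type u) [Field K] {N : Type v} [AddCommGroup N]
    [Module (Polynomial K) N] (𝓝 : ℕ → AddSubgroup N) : Prop where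
  monomial_smul_mem : ∀ (n d : ℕ) (c : K), ∀ y ∈ 𝓝 d, Polynomial.monomial n c • y ∈ 𝓝 (n + d)
  exists_projection : ∀ d, ∃ P : N →+ N, ∀ e, ∀ y ∈ 𝓝 e, P y = if e = d then y else 0
  span_eq_top : Submodule.span (Polynomial K) {y | ∃ d, y ∈ 𝓝 d} = ⊤

variable {K : Type u} [Field K] {r : ℕ} {M : Type v} [AddCommGroup M]
  [Module (MvPolynomial (Fin r) K) M] {𝓜 : (Fin r →₀ ℕ) → AddSubgroup M}

theorem IsMultigrading.degree_projection_smul (h : IsMultigrading K 𝓜) {P : M →+ M} {d : ℕ}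
    (hP : ∀ u, ∀ m ∈ 𝓜 u, P m = if u.degree = d then m else 0) {u : Fin r →₀ ℕ} {m : M}
    (hm : m ∈ 𝓜 u) {k : ℕ} {s : MvPolynomial (Fin r) K} (hs : s.IsHomogeneous k) :
    P (s • m) = if u.degree + k = d then s • m else 0 := by
  have key : ∀ v ∈ s.support, P (monomial v (s.coeff v) • m)
      = if u.degree + k = d then monomial v (s.coeff v) • m else 0 := by
    intro v hv
    have hk : v.degree = k := by
      rw [Finsupp.degree_eq_weight_one]
      exact hs (mem_support_iff.1 hv)
    rw [hP _ _ (h.smul_mem v u _ m hm), map_add, hk, add_comm]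
  conv_lhs => rw [s.as_sum, Finset.sum_smul, map_sum, Finset.sum_congr rfl key]
  split_ifs
  · rw [← Finset.sum_smul, ← s.as_sum]
  · simp

/-- The generators of `p` are homogeneous for total degree. Hence the projection of `M` descends to
`M / pM ≅ S/p ⊗ M`, where it separates the degrees. -/
theorem IsMultigrading.degree_projection_mem (h : IsMultigrading K 𝓜) {P : M →+ M} {d : ℕ}
    (hP : ∀ u, ∀ m ∈ 𝓜 u, P m = if u.degree = d then m else 0) {x : M}
    (hx : x ∈ diagIdeal K r • (⊤ : Submodule (MvPolynomial (Fin r) K) M)) :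
    P x ∈ diagIdeal K r • (⊤ : Submodule (MvPolynomial (Fin r) K) M) := by
  refine Submodule.smul_induction_on (p := fun x => P x ∈ diagIdeal K r • ⊤) hx ?_
    fun x y hx hy => by rw [map_add]; exact add_mem hx hy
  intro f hf m _
  unfold diagIdeal at hf
  induction hf using Submodule.span_induction generalizing m with
  | mem f hf =>
    have hfI : f ∈ diagIdeal K r := Ideal.subset_span hf
    obtain ⟨i, hi, rfl⟩ := hf
    refine isInternal_induction h.isInternal (p := fun m => P (_ • m) ∈ diagIdeal K r • ⊤)
      (by simp) ?_ (fun x y hx hy => by rw [smul_add, map_add]; exact add_mem hx hy) m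
    intro u m hm
    rw [h.degree_projection_smul hP hm ((isHomogeneous_X K _).sub (isHomogeneous_X K _))]
    split_ifs
    · exact Submodule.smul_mem_smul hfI trivial
    · exact zero_mem _
  | zero => simp
  | add f g _ _ hf hg =>
    rw [add_smul, map_add]
    exact add_mem (hf m trivial) (hg m trivial)
  -- The scalar `a` is moved onto the module element, which is why the induction generalizes `m`.
  | smul a f _ hf =>
    rw [smul_eq_mul, mul_comm, mul_smul]
    exact hf _ trivial

theorem IsMultigrading.isPolyGrading_diagGrading [NeZero r] (h : IsMultigrading K 𝓜) :
    IsPolyGrading K (diagGrading K 𝓜) where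
  monomial_smul_mem := by
    intro n d c y hy
    induction hy using AddSubgroup.closure_induction with
    | mem y hy =>
      obtain ⟨u, k, m, s, hm, hs, hd, rfl⟩ := hy
      refine AddSubgroup.subset_closure
        ⟨u, n + k, m, C c * X 0 ^ n * s, hm, ?_, by omega, ?_⟩
      · simpa using ((isHomogeneous_C _ c).mul (isHomogeneous_X_pow (R := K) (0 : Fin r) n)).mul hs
      · change (diagEquiv K r).symm (Polynomial.monomial n c) •
          (Ideal.Quotient.mk (diagIdeal K r) s ⊗ₜ[MvPolynomial (Fin r) K] m) = _
        have : (diagEquiv K r).symm (Polynomial.monomial n c)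
            = Ideal.Quotient.mk (diagIdeal K r) (C c * X 0 ^ n) := by
          change Polynomial.aeval (Ideal.Quotient.mk (diagIdeal K r) (X 0))
            (Polynomial.monomial n c) = _
          rw [Polynomial.aeval_monomial, map_mul, map_pow]
          rfl
        rw [this, TensorProduct.smul_tmul', smul_eq_mul, ← map_mul]
    | zero => rw [smul_zero]; exact zero_mem _
    | add x y _ _ hx hy => rw [smul_add]; exact add_mem hx hy
    | neg x _ hx => rw [smul_neg]; exact neg_mem hx
  exists_projection := by
    intro d
    obtain ⟨P, hP⟩ := exists_projection h.isInternal (fun u => u.degree = d)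
    let I := diagIdeal K r • (⊤ : Submodule (MvPolynomial (Fin r) K) M)
    let ε : DiagIntersection K r M ≃+ M ⧸ I :=
      (TensorProduct.quotTensorEquivQuotSMul M (diagIdeal K r)).toAddEquiv
    let Q : M ⧸ I →+ M ⧸ I := QuotientAddGroup.map I.toAddSubgroup I.toAddSubgroup P
      fun x hx => h.degree_projection_mem hP hx
    refine ⟨(ε.symm.toAddMonoidHom.comp Q).comp ε.toAddMonoidHom, ?_⟩
    intro e y hy
    induction hy using AddSubgroup.closure_induction with
    | mem y hy =>
      obtain ⟨u, k, m, s, hm, hs, hd, hy⟩ := hy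
      rw [AddMonoidHom.comp_apply, AddMonoidHom.comp_apply, AddEquiv.coe_toAddMonoidHom,
        AddEquiv.coe_toAddMonoidHom]
      have hε : ε y = I.mkQ (s • m) := by
        rw [hy]
        exact TensorProduct.quotTensorEquivQuotSMul_mk_tmul _ _ _
      have hQ : ∀ x, Q (I.mkQ x) = I.mkQ (P x) := fun x => rfl
      rw [hε, hQ, h.degree_projection_smul hP hm hs, hd]
      split_ifs
      · rw [← hε, AddEquiv.symm_apply_apply]
      · rw [map_zero, map_zero]
    | zero => simp
    | add x y _ _ hx hy =>
      rw [map_add, hx, hy]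
      split_ifs <;> simp
    | neg x _ hx =>
      rw [map_neg, hx]
      split_ifs <;> simp
  span_eq_top := by
    rw [eq_top_iff]
    intro y _
    have hsmul : ∀ (a : DiagRing K r) (x : DiagIntersection K r M), a • x = diagEquiv K r a • x := by
      intro a x
      change _ = (diagEquiv K r).symm (diagEquiv K r a) • x
      rw [AlgEquiv.symm_apply_apply]
    refine TensorProduct.induction_on (R := MvPolynomial (Fin r) K)
      (motive := fun y : DiagRing K r ⊗[MvPolynomial (Fin r) K] M =>
        (show DiagIntersection K r M from y) ∈ Submodule.span (Polynomial K)
          {y : DiagIntersection K r M | ∃ d, y ∈ diagGrading K 𝓜 d}) y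
      (zero_mem _) (fun a m => ?_) (fun x y hx hy => add_mem hx hy)
    refine isInternal_induction h.isInternal (p := fun m =>
        (show DiagIntersection K r M from a ⊗ₜ[MvPolynomial (Fin r) K] m) ∈
          Submodule.span (Polynomial K)
          {y : DiagIntersection K r M | ∃ d, y ∈ diagGrading K 𝓜 d}) ?_ ?_ ?_ m
    · rw [TensorProduct.tmul_zero]
      exact zero_mem _
    · intro u m hm
      have h1 : (show DiagIntersection K r M from a ⊗ₜ[MvPolynomial (Fin r) K] m)
          = diagEquiv K r a • (show DiagIntersection K r M from
            (1 : DiagRing K r) ⊗ₜ[MvPolynomial (Fin r) K] m) := by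
        rw [← hsmul]
        change _ = a • ((1 : DiagRing K r) ⊗ₜ[MvPolynomial (Fin r) K] m)
        rw [TensorProduct.smul_tmul', smul_eq_mul, mul_one]
      rw [h1]
      refine Submodule.smul_mem _ _ (Submodule.subset_span ⟨u.degree,
        AddSubgroup.subset_closure ⟨u, 0, m, 1, hm, isHomogeneous_one _ _, by simp, ?_⟩⟩)
      rw [map_one]
    · intro x y hx hy
      rw [TensorProduct.tmul_add]
      exact add_mem hx hy

theorem finite_diagIntersection [NeZero r] [Module.Finite (MvPolynomial (Fin r) K) M] :
    Module.Finite (Polynomial K) (DiagIntersection K r M) := by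
  have h : Module.Finite (DiagRing K r) (DiagIntersection K r M) :=
    inferInstanceAs (Module.Finite (DiagRing K r) (DiagRing K r ⊗[MvPolynomial (Fin r) K] M))
  obtain ⟨s, hs⟩ := h.fg_top
  refine ⟨s, ?_⟩
  rw [eq_top_iff]
  intro y _
  have hy : y ∈ Submodule.span (DiagRing K r) (s : Set (DiagIntersection K r M)) :=
    hs ▸ Submodule.mem_top
  induction hy using Submodule.span_induction with
  | mem x hx => exact Submodule.subset_span hx
  | zero => exact zero_mem _
  | add x y _ _ hx hy => exact add_mem (hx trivial) (hy trivial)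
  | smul a x _ hx =>
    have : a • x = diagEquiv K r a • x := by
      change _ = (diagEquiv K r).symm (diagEquiv K r a) • x
      rw [AlgEquiv.symm_apply_apply]
    rw [this]
    exact Submodule.smul_mem _ _ (hx trivial)

theorem rank_diagIntersection [NeZero r] :
    Module.rank (Polynomial K) (DiagIntersection K r M)
      = Module.rank (DiagRing K r) (DiagIntersection K r M) :=
  rank_eq_of_equiv_equiv (diagEquiv K r).symm (AddEquiv.refl _)
    (diagEquiv K r).symm.bijective fun _ _ => rfl

end Diagonal

/-! ### Barcodes of graded modules over `K[x]` -/

section GradedStructure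

open Polynomial

variable {K : Type u} [Field K]

/-- The part of degree `d` of `f`, seen as an element of `K[x](-a)`. -/
def shiftedPart (a d : ℕ) (f : K[X]) : K[X] :=
  if a ≤ d then monomial (d - a) (f.coeff (d - a)) else 0

theorem isShiftedHomogeneous_shiftedPart (a d : ℕ) (f : K[X]) :
    IsShiftedHomogeneous a d (shiftedPart a d f) := by
  intro n hn
  unfold shiftedPart at hn
  split_ifs at hn with h
  · rw [coeff_monomial] at hn
    have : d - a = n := by by_contra h'; exact hn (if_neg h')
    omega
  · simp at hn

theorem IsShiftedHomogeneous.eq_shiftedPart {a d : ℕ} {f : K[X]} (h : IsShiftedHomogeneous a d f) :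
    f = shiftedPart a d f := by
  ext n
  unfold shiftedPart
  by_cases hn : f.coeff n = 0
  · split_ifs
    · rw [coeff_monomial]
      split_ifs with h'
      · rw [h']
      · exact hn
    · simpa using hn
  · have := h n hn
    rw [if_pos (by omega), coeff_monomial, if_pos (by omega)]
    congr 1
    omega

variable {N : Type v} [AddCommGroup N] [Module K[X] N] {𝓝 : ℕ → AddSubgroup N}

theorem IsPolyGrading.projection_smul (h : IsPolyGrading K 𝓝) {d : ℕ} {P : N →+ N}
    (hP : ∀ e, ∀ y ∈ 𝓝 e, P y = if e = d then y else 0) {a : ℕ} {y : N} (hy : y ∈ 𝓝 a)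
    (f : K[X]) : P (f • y) = shiftedPart a d f • y := by
  induction f using Polynomial.induction_on' with
  | add f g hf hg =>
    rw [add_smul, map_add, hf, hg, ← add_smul]
    congr 1
    unfold shiftedPart
    split_ifs <;> simp
  | monomial n c =>
    rw [hP _ _ (h.monomial_smul_mem n a c y hy)]
    unfold shiftedPart
    by_cases hn : n + a = d
    · rw [if_pos hn, if_pos (by omega), show d - a = n by omega, coeff_monomial, if_pos rfl]
    · rw [if_neg hn]
      split_ifs with had
      · rw [coeff_monomial, if_neg (by omega), map_zero, zero_smul]
      · rw [zero_smul]

theorem IsPolyGrading.shifted_smul_mem (h : IsPolyGrading K 𝓝) {a d : ℕ} {y : N} (hy : y ∈ 𝓝 a)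
    {f : K[X]} (hf : IsShiftedHomogeneous a d f) : f • y ∈ 𝓝 d := by
  rw [hf.eq_shiftedPart]
  unfold shiftedPart
  split_ifs with had
  · have := h.monomial_smul_mem (d - a) a (f.coeff (d - a)) y hy
    rwa [Nat.sub_add_cancel had] at this
  · rw [zero_smul]
    exact zero_mem _

/-- The least `n` with `x^n y = 0`. -/
def nilOrder (K : Type u) [Field K] {N : Type v} [AddCommGroup N] [Module K[X] N] (y : N) : ℕ∞ :=
  ⨅ (n : ℕ) (_ : (X : K[X]) ^ n • y = 0), (n : ℕ∞)

theorem nilOrder_le_iff {y : N} {n : ℕ} : nilOrder K y ≤ n ↔ (X : K[X]) ^ n • y = 0 := by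
  classical
  constructor
  · intro h
    by_cases hex : ∃ k, (X : K[X]) ^ k • y = 0
    · have h1 : ((Nat.find hex : ℕ) : ℕ∞) ≤ nilOrder K y :=
        le_iInf₂ fun k hk => by exact_mod_cast Nat.find_min' hex hk
      have h2 : Nat.find hex ≤ n := by exact_mod_cast h1.trans h
      obtain ⟨c, rfl⟩ := Nat.exists_eq_add_of_le' h2
      rw [pow_add, mul_smul, Nat.find_spec hex, smul_zero]
    · have : nilOrder K y = ⊤ := by
        unfold nilOrder
        simp only [iInf_eq_top]
        exact fun k hk => (hex ⟨k, hk⟩).elim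
      rw [this, top_le_iff] at h
      exact (ENat.natCast_ne_top n h).elim
  · exact fun h => iInf₂_le n h

/-- Projecting `f • y = 0` to degree `n + a` isolates the `x^n` term, whose coefficient is
invertible. -/
theorem IsPolyGrading.nilOrder_le_of_smul_eq_zero (h : IsPolyGrading K 𝓝) {a : ℕ} {y : N}
    (hy : y ∈ 𝓝 a) {f : K[X]} (hf : f • y = 0) {n : ℕ} (hn : f.coeff n ≠ 0) :
    nilOrder K y ≤ n := by
  obtain ⟨P, hP⟩ := h.exists_projection (n + a)
  have h1 : shiftedPart a (n + a) f • y = 0 := by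
    rw [← h.projection_smul hP hy, hf, map_zero]
  unfold shiftedPart at h1
  rw [if_pos (by omega), Nat.add_sub_cancel, ← C_mul_X_pow_eq_monomial, mul_smul] at h1
  rw [nilOrder_le_iff]
  have := congr_arg (fun z => C (f.coeff n)⁻¹ • z) h1
  simpa [smul_smul, ← C_mul, ← mul_assoc, inv_mul_cancel₀ hn] using this

/-- A relation between homogeneous generators that is not a relation termwise lets one replace a
generator by one of the same degree and smaller order. -/
theorem IsPolyGrading.exists_smaller_generators (h : IsPolyGrading K 𝓝) {n : ℕ} {g : Fin n → N}
    {a : Fin n → ℕ} (hg : ∀ i, g i ∈ 𝓝 (a i)) (hspan : Submodule.span K[X] (Set.range g) = ⊤)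
    {f : Fin n → K[X]} (hf : ∑ i, f i • g i = 0) {i₀ : Fin n} (hi₀ : f i₀ • g i₀ ≠ 0) :
    ∃ g' : Fin n → N, (∀ i, g' i ∈ 𝓝 (a i)) ∧ Submodule.span K[X] (Set.range g') = ⊤ ∧
      (fun i => nilOrder K (g' i)) < fun i => nilOrder K (g i) := by
  classical
  obtain ⟨d, hd⟩ : ∃ d, shiftedPart (a i₀) d (f i₀) • g i₀ ≠ 0 := by
    by_contra! hall
    apply hi₀
    rw [(f i₀).as_sum_support, Finset.sum_smul]
    refine Finset.sum_eq_zero fun k _ => ?_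
    have := hall (k + a i₀)
    unfold shiftedPart at this
    rwa [if_pos (by omega), Nat.add_sub_cancel] at this
  obtain ⟨P, hP⟩ := h.exists_projection d
  set p : Fin n → K[X] := fun i => shiftedPart (a i) d (f i) with hp
  have hsum : ∑ i, p i • g i = 0 := by
    have := congr_arg P hf
    rw [map_sum, map_zero] at this
    rw [← this]
    exact Finset.sum_congr rfl fun i _ => (h.projection_smul hP (hg i) _).symm
  set T := Finset.univ.filter fun i => p i • g i ≠ 0 with hT
  have hTne : T.Nonempty := ⟨i₀, by simpa [hT] using hd⟩
  -- The largest generator degree has the smallest exponent `d - a i`, so `x^(d - a i)` divides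
  -- every coefficient of the relation.
  obtain ⟨i, hiT, himax⟩ := T.exists_max_image a hTne
  have hTsum : ∑ j ∈ T, p j • g j = 0 := by
    rw [← hsum]
    refine Finset.sum_subset (Finset.subset_univ _) fun j _ hj => ?_
    simpa [hT] using hj
  have hform : ∀ j ∈ T, a j ≤ d ∧ p j = monomial (d - a j) ((f j).coeff (d - a j)) := by
    intro j hj
    have hne : p j • g j ≠ 0 := by simpa [hT] using hj
    by_cases had : a j ≤ d
    · exact ⟨had, if_pos had⟩
    · exact (hne (by rw [hp]; simp [shiftedPart, had])).elim
  set c : Fin n → K := fun j => (f j).coeff (d - a j) with hc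
  have hpi : p i • g i ≠ 0 := by simpa [hT] using hiT
  have hci : c i ≠ 0 := by
    intro h0
    apply hpi
    rw [(hform i hiT).2]
    change monomial _ (c i) • _ = _
    rw [h0, map_zero, zero_smul]
  -- Dividing the relation by `c i * x^(d - a i)` gives `y`, in which `g i` has coefficient `1`.
  -- Thus `y` can replace `g i`, and `x^(d - a i)` kills `y` but not `g i`.
  set q : Fin n → K[X] := fun j => monomial (a i - a j) (c j / c i) with hq
  set y : N := ∑ j ∈ T, q j • g j with hy
  have hymem : y ∈ 𝓝 (a i) := by
    refine sum_mem fun j hj => ?_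
    have := h.monomial_smul_mem (a i - a j) (a j) (c j / c i) _ (hg j)
    rwa [Nat.sub_add_cancel (himax j hj)] at this
  have hy0 : (X : K[X]) ^ (d - a i) • y = 0 := by
    have : (X : K[X]) ^ (d - a i) • y = C (c i)⁻¹ • ∑ j ∈ T, p j • g j := by
      rw [hy, Finset.smul_sum, Finset.smul_sum]
      refine Finset.sum_congr rfl fun j hj => ?_
      rw [smul_smul, smul_smul, (hform j hj).2, hq]
      congr 1
      rw [X_pow_mul_monomial, C_mul_monomial]
      have h1 := himax j hj
      have h2 := (hform i hiT).1
      rw [show a i - a j + (d - a i) = d - a j by omega, div_eq_inv_mul]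
    rw [this, hTsum, smul_zero]
  have hlt : nilOrder K y < nilOrder K (g i) := by
    refine (nilOrder_le_iff.2 hy0).trans_lt (lt_of_not_ge fun hle => hpi ?_)
    rw [(hform i hiT).2, ← C_mul_X_pow_eq_monomial, mul_smul, nilOrder_le_iff.1 hle, smul_zero]
  refine ⟨Function.update g i y, fun j => ?_, ?_, ?_⟩
  · by_cases hj : j = i
    · subst hj
      simpa using hymem
    · simpa [Function.update_of_ne hj] using hg j
  · rw [eq_top_iff, ← hspan, Submodule.span_le]
    have hothers : ∀ j ≠ i, g j ∈ Submodule.span K[X] (Set.range (Function.update g i y)) :=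
      fun j hj => Submodule.subset_span ⟨j, by simp [Function.update_of_ne hj]⟩
    rintro _ ⟨j, rfl⟩
    by_cases hj : j = i
    · subst hj
      have hqi : q j = 1 := by simp [hq, div_self hci]
      have : g j = y - ∑ k ∈ T.erase j, q k • g k := by
        rw [hy, ← Finset.add_sum_erase T _ hiT, hqi, one_smul, add_sub_cancel_right]
      rw [SetLike.mem_coe, this]
      refine sub_mem (Submodule.subset_span ⟨j, by simp⟩) (sum_mem fun k hk => ?_)
      exact Submodule.smul_mem _ _ (hothers k (Finset.ne_of_mem_erase hk))
    · exact hothers j hj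
  · rw [Pi.lt_def]
    refine ⟨fun j => ?_, i, by simpa using hlt⟩
    by_cases hj : j = i
    · subst hj
      simpa using hlt.le
    · simp [Function.update_of_ne hj]

/-- The product order on `Fin n → ℕ∞` is well-founded, so some generating family has minimal orders;
a relation that is not termwise would contradict minimality. -/
theorem IsPolyGrading.exists_independent_generators [Module.Finite K[X] N]
    (h : IsPolyGrading K 𝓝) :
    ∃ (n : ℕ) (g : Fin n → N) (a : Fin n → ℕ), (∀ i, g i ∈ 𝓝 (a i)) ∧
      Submodule.span K[X] (Set.range g) = ⊤ ∧
      ∀ f : Fin n → K[X], ∑ i, f i • g i = 0 → ∀ i, f i • g i = 0 := by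
  obtain ⟨n, g₀, a, hg₀, hspan₀⟩ := exists_homogeneous_generators h.span_eq_top
  let S : Set (Fin n → N) := {g | (∀ i, g i ∈ 𝓝 (a i)) ∧ Submodule.span K[X] (Set.range g) = ⊤}
  obtain ⟨g, ⟨hg, hspan⟩, hmin⟩ := (InvImage.wf (fun (g : Fin n → N) i => nilOrder K (g i))
    (wellFounded_lt (α := Fin n → ℕ∞))).has_min S ⟨g₀, hg₀, hspan₀⟩
  refine ⟨n, g, a, hg, hspan, fun f hf i => ?_⟩
  by_contra hi
  obtain ⟨g', hg', hspan', hlt⟩ := h.exists_smaller_generators hg hspan hf hi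
  exact hmin g' ⟨hg', hspan'⟩ hlt

theorem IsPolyGrading.isBarcodeOf (h : IsPolyGrading K 𝓝) (B : Barcode)
    (g : Fin B.numInfinite → N) (t : Fin B.numFinite → N)
    (hg : ∀ i, g i ∈ 𝓝 (B.infBirth i)) (ht : ∀ j, t j ∈ 𝓝 (B.finBirth j))
    (hspan : Submodule.span K[X] (Set.range g ∪ Set.range t) = ⊤)
    (hzero : ∀ j, (X : K[X]) ^ B.finLength j • t j = 0)
    (hrel : ∀ (f : Fin B.numInfinite → K[X]) (f' : Fin B.numFinite → K[X]),
      ∑ i, f i • g i + ∑ j, f' j • t j = 0 →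
        (∀ i, f i = 0) ∧ ∀ j, (X : K[X]) ^ B.finLength j ∣ f' j) :
    IsBarcodeOf K 𝓝 B := by
  classical
  let Ψ : ∀ j, (K[X] ⧸ Ideal.span {(X : K[X]) ^ B.finLength j}) →ₗ[K[X]] N := fun j =>
    Submodule.liftQ _ (LinearMap.toSpanSingleton K[X] N (t j)) (by
      rw [Ideal.span, Submodule.span_le]
      rintro _ rfl
      exact hzero j)
  let Φ : ((Fin B.numInfinite → K[X]) ×
      ((j : Fin B.numFinite) → K[X] ⧸ Ideal.span {(X : K[X]) ^ B.finLength j})) →ₗ[K[X]] N :=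
    (Fintype.linearCombination K[X] g).coprod (∑ j, Ψ j ∘ₗ LinearMap.proj j)
  have hΦ : ∀ (f : Fin B.numInfinite → K[X]) (f' : Fin B.numFinite → K[X]),
      Φ (f, fun j => Ideal.Quotient.mk _ (f' j))
      = ∑ i, f i • g i + ∑ j, f' j • t j := by
    intro f f'
    simp only [Φ, LinearMap.coprod_apply, Fintype.linearCombination_apply, LinearMap.sum_apply,
      LinearMap.comp_apply, LinearMap.proj_apply]
    rfl
  have hlift : ∀ z : ((Fin B.numInfinite → K[X]) ×
      ((j : Fin B.numFinite) → K[X] ⧸ Ideal.span {(X : K[X]) ^ B.finLength j})),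
      ∃ (f : Fin B.numInfinite → K[X]) (f' : Fin B.numFinite → K[X]), z = (f, fun j => Ideal.Quotient.mk _ (f' j)) := by
    rintro ⟨f, z⟩
    choose f' hf' using fun j => Ideal.Quotient.mk_surjective (z j)
    exact ⟨f, f', by simp [hf']⟩
  have hinj : Function.Injective Φ := by
    rw [injective_iff_map_eq_zero]
    intro z hz
    obtain ⟨f, f', rfl⟩ := hlift z
    rw [hΦ] at hz
    obtain ⟨h1, h2⟩ := hrel f f' hz
    refine Prod.ext (funext h1) (funext fun j => ?_)
    exact Ideal.Quotient.eq_zero_iff_mem.2 (Ideal.mem_span_singleton.2 (h2 j))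
  have hsurj : Function.Surjective Φ := by
    rw [← LinearMap.range_eq_top, eq_top_iff, ← hspan, Submodule.span_le]
    rintro _ (⟨i, rfl⟩ | ⟨j, rfl⟩)
    · refine ⟨(Pi.single i 1, fun j => Ideal.Quotient.mk _ ((0 : Fin _ → K[X]) j)), ?_⟩
      rw [hΦ]
      simp [Pi.single_apply, ite_smul]
    · refine ⟨((0 : Fin _ → K[X]), fun k => Ideal.Quotient.mk _
        ((Pi.single j 1 : Fin B.numFinite → K[X]) k)), ?_⟩
      rw [hΦ]
      simp [Pi.single_apply, ite_smul]
  refine ⟨(LinearEquiv.ofBijective Φ ⟨hinj, hsurj⟩).symm, fun d y => ?_⟩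
  obtain ⟨z, rfl⟩ := hsurj y
  have hsymm : (LinearEquiv.ofBijective Φ ⟨hinj, hsurj⟩).symm (Φ z) = z :=
    (LinearEquiv.ofBijective Φ ⟨hinj, hsurj⟩).symm_apply_apply z
  rw [hsymm]
  constructor
  · intro hy
    obtain ⟨f, f', rfl⟩ := hlift z
    -- Projection to degree `d` fixes `Φ z` and replaces the coordinates by their degree-`d` parts;
    -- injectivity of `Φ` then shows that `z` is its own degree-`d` part.
    obtain ⟨P, hP⟩ := h.exists_projection d
    have h1 := hP d _ hy
    rw [if_pos rfl, hΦ, map_add, map_sum, map_sum,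
      Finset.sum_congr rfl fun i _ => h.projection_smul hP (hg i) (f i),
      Finset.sum_congr rfl fun j _ => h.projection_smul hP (ht j) (f' j), ← hΦ, ← hΦ] at h1
    have h2 := hinj h1
    rw [← h2]
    exact ⟨fun i => isShiftedHomogeneous_shiftedPart _ _ _,
      fun j => ⟨_, isShiftedHomogeneous_shiftedPart _ _ _, rfl⟩⟩
  · rintro ⟨h1, h2⟩
    obtain ⟨f, z⟩ := z
    choose f' hf' hz using h2
    obtain rfl : (fun j => Ideal.Quotient.mk _ (f' j)) = z := funext hz
    rw [hΦ]
    exact add_mem (sum_mem fun i _ => h.shifted_smul_mem (hg i) (h1 i))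
      (sum_mem fun j _ => h.shifted_smul_mem (ht j) (hf' j))

theorem IsPolyGrading.exists_barcode [Module.Finite K[X] N] (h : IsPolyGrading K 𝓝) :
    ∃ B : Barcode, IsBarcodeOf K 𝓝 B := by
  classical
  obtain ⟨n, g, a, hg, hspan, hrel⟩ := h.exists_independent_generators
  let I := {i : Fin n // nilOrder K (g i) = ⊤}
  -- Order `0` means that the generator is zero. Such generators are dropped, so that finite bars
  -- are non-empty.
  let J := {i : Fin n // nilOrder K (g i) ≠ ⊤ ∧ nilOrder K (g i) ≠ 0}
  let σ : Fin (Fintype.card I) → Fin n := fun i => ((Fintype.equivFin I).symm i).1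
  let τ : Fin (Fintype.card J) → Fin n := fun j => ((Fintype.equivFin J).symm j).1
  have hσ : ∀ i, nilOrder K (g (σ i)) = ⊤ := fun i => ((Fintype.equivFin I).symm i).2
  have hτ : ∀ j, nilOrder K (g (τ j)) ≠ ⊤ ∧ nilOrder K (g (τ j)) ≠ 0 :=
    fun j => ((Fintype.equivFin J).symm j).2
  have hστ : Function.Injective (Sum.elim σ τ) := by
    refine Function.Injective.sumElim
      (Subtype.val_injective.comp (Fintype.equivFin I).symm.injective)
      (Subtype.val_injective.comp (Fintype.equivFin J).symm.injective) fun i j hij => ?_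
    exact (hτ j).1 (hij ▸ hσ i)
  have hcoe : ∀ j, (((nilOrder K (g (τ j))).toNat : ℕ) : ℕ∞) = nilOrder K (g (τ j)) :=
    fun j => ENat.natCast_toNat (hτ j).1
  let B : Barcode :=
    { numInfinite := Fintype.card I
      infBirth := fun i => a (σ i)
      numFinite := Fintype.card J
      finBirth := fun j => a (τ j)
      finLength := fun j => (nilOrder K (g (τ j))).toNat
      finLength_pos := fun j => Nat.pos_of_ne_zero fun h0 => (hτ j).2 (by
        rw [← hcoe j, h0, Nat.cast_zero]) }
  refine ⟨B, h.isBarcodeOf B (fun i => g (σ i)) (fun j => g (τ j)) (fun i => hg _)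
    (fun j => hg _) ?_ (fun j => nilOrder_le_iff.1 (hcoe j).ge) ?_⟩
  · rw [eq_top_iff, ← hspan, Submodule.span_le]
    rintro _ ⟨i, rfl⟩
    by_cases hi : nilOrder K (g i) = ⊤
    · exact Submodule.subset_span (Or.inl ⟨Fintype.equivFin I ⟨i, hi⟩, by simp [σ]⟩)
    · by_cases hi0 : nilOrder K (g i) = 0
      · have : (X : K[X]) ^ 0 • g i = 0 := nilOrder_le_iff.1 (by simp [hi0])
        rw [pow_zero, one_smul] at this
        rw [this]
        exact zero_mem _
      · exact Submodule.subset_span (Or.inr ⟨Fintype.equivFin J ⟨i, hi, hi0⟩, by simp [τ]⟩)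
  · intro f f' hff
    let F : Fin n → K[X] := Function.extend (Sum.elim σ τ) (Sum.elim f f') 0
    have hF : ∀ k, F (Sum.elim σ τ k) = Sum.elim f f' k := fun k => hστ.extend_apply _ _ _
    have hsum : ∑ i, F i • g i = 0 := by
      rw [← hff, ← Fintype.sum_of_injective (Sum.elim σ τ) hστ
        (fun k => Sum.elim f f' k • g (Sum.elim σ τ k)) (fun i => F i • g i) ?_ ?_]
      · rw [Fintype.sum_sum_type]
        rfl
      · intro i hi
        have : F i = 0 := Function.extend_apply' _ _ _ hi
        rw [this, zero_smul]
      · intro k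
        rw [hF]
    have hall := hrel F hsum
    constructor
    · intro i
      have h1 : f i • g (σ i) = 0 := by
        have := hall (σ i)
        rwa [show F (σ i) = f i from hF (Sum.inl i)] at this
      ext k
      by_contra hk
      have := h.nilOrder_le_of_smul_eq_zero (hg _) h1 hk
      rw [hσ, top_le_iff] at this
      exact ENat.natCast_ne_top k this
    · intro j
      have h1 : f' j • g (τ j) = 0 := by
        have := hall (τ j)
        rwa [show F (τ j) = f' j from hF (Sum.inr j)] at this
      rw [X_pow_dvd_iff]
      intro k hk
      by_contra hk'
      have := h.nilOrder_le_of_smul_eq_zero (hg _) h1 hk'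
      rw [← hcoe j, Nat.cast_le] at this
      exact absurd hk (not_lt.2 this)

theorem IsBarcodeOf.rk_eq {B : Barcode} (h : IsBarcodeOf K 𝓝 B) : rk K[X] N = B.numInfinite := by
  obtain ⟨e, -⟩ := h
  -- The sum bounds each length, so `x^c` kills all finite bars.
  let c := ∑ j, B.finLength j
  refine rk_eq_of_comp_eq_smul K[X] N (s := X ^ c)
    (e.symm.toLinearMap ∘ₗ LinearMap.inl K[X] _ _)
    ((X ^ c : K[X]) • (LinearMap.fst K[X] _ _ ∘ₗ e.toLinearMap)) (pow_ne_zero _ X_ne_zero) ?_ ?_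
  · refine LinearMap.ext fun f => ?_
    simp
  · refine LinearMap.ext fun y => e.injective ?_
    simp only [LinearMap.comp_apply, LinearMap.smul_apply, LinearEquiv.coe_coe,
      LinearEquiv.apply_symm_apply, LinearMap.id_apply, map_smul, LinearMap.inl_apply,
      LinearMap.fst_apply]
    refine Prod.ext rfl (funext fun j => ?_)
    change (X ^ c : K[X]) • 0 = (X ^ c : K[X]) • (e y).2 j
    obtain ⟨p, hp⟩ := Ideal.Quotient.mk_surjective ((e y).2 j)
    rw [smul_zero, ← hp]
    refine (Ideal.Quotient.eq_zero_iff_mem.2 (Ideal.mem_span_singleton.2 ?_)).symm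
    exact (pow_dvd_pow X (Finset.single_le_sum (f := B.finLength) (fun _ _ => Nat.zero_le _)
      (Finset.mem_univ j))).mul_right p

end GradedStructure

theorem rk_polynomial_eq_rk_diagRing {K : Type u} [Field K] {r : ℕ} [NeZero r] {M : Type v}
    [AddCommGroup M] [Module (MvPolynomial (Fin r) K) M] :
    rk (Polynomial K) (DiagIntersection K r M) = rk (DiagRing K r) (DiagIntersection K r M) := by
  rw [← lift_rank_eq_rk, ← lift_rank_eq_rk, rank_diagIntersection]

end DiagonalRank

end

theorem theorem5p2 {K : Type*} [Field K] {r : ℕ} [NeZero r] (hr : 2 ≤ r)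
    {M : Type*} [AddCommGroup M] [Module (MvPolynomial (Fin r) K) M]
    [Module.Finite (MvPolynomial (Fin r) K) M]
    (𝓜 : (Fin r →₀ ℕ) → AddSubgroup M) (h𝓜 : DiagonalRank.IsMultigrading K 𝓜) :
    DiagonalRank.rk (MvPolynomial (Fin r) K) M
        = DiagonalRank.rk (DiagonalRank.DiagRing K r) (DiagonalRank.DiagIntersection K r M) ∧
    (∃ B : DiagonalRank.Barcode,
      DiagonalRank.IsBarcodeOf K (DiagonalRank.diagGrading K 𝓜) B) ∧
    (∀ B : DiagonalRank.Barcode, DiagonalRank.IsBarcodeOf K (DiagonalRank.diagGrading K 𝓜) B →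
      (B.numInfinite : Cardinal) = DiagonalRank.rk (MvPolynomial (Fin r) K) M) := by
  obtain ⟨n, h1, h2⟩ := h𝓜.exists_rk_eq
  refine ⟨h1.trans h2.symm, ?_, fun B hB => ?_⟩
  · have := DiagonalRank.finite_diagIntersection (K := K) (r := r) (M := M)
    exact h𝓜.isPolyGrading_diagGrading.exists_barcode
  · rw [h1, ← h2, ← DiagonalRank.rk_polynomial_eq_rk_diagRing, hB.rk_eq]
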